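/- Let $K$ be a perfect field of characteristic $2$ (for instance $K=\mathbb F_2$, or its algebraic closure), and let $x,y,z$ be homogeneous coordinates on $\mathbb P^2_K$. Terminology. An integral plane curve is rational over $K$ if its function field is $K$-isomorphic to $K(t)$. A point is singular if the form defining the curve and all its partial derivatives vanish there. A singular point is a cusp if a local equation of the curve there is irreducible in the formal power series ring. Two power series in $K[[x,z]]$ are formally equivalent if some $K$-automorphism of $K[[x,z]]$ takes the ideal generated by the first to the ideal generated by the second; a singular point has normal form $g$ if a local equation of the curve there is formally equivalent to $g$. For even $m$, a singular point is of type $A_m$ if it has normal form $z^2+x^{m+1}$, or $z^2+zx^r+x^{m+1}$ for some $r$ with $m/2<r<m$. (1) For every $n\ge 1$, the curve $$C_{2^n,2}:=\bigl(z^2y^{2^n}=x^{2^n+2}+xz^{2^n+1}\bigr)\subset\mathbb P^2_K$$ is an integral curve of degree $2^n+2$ that is rational over $K$. It has exactly one singular point in $\mathbb P^2(K)$. This point is a cusp of multiplicity $2$ and of type $A_m$, where $m=2^n(2^n+1)$, with normal form $$z^2+zx^r+x^{m+1},\qquad r=\tfrac12 m+2^{n-1}+1 .$$ (2) For every $n\ge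 2$, the curve $$C_{2^n}:=\bigl(y^{2^n}=x^{2^n-2}z^2+xz^{2^n-1}\bigr)\subset\mathbb P^2_K,$$ whose equation in the affine chart $x=1$ is $y^{2^n}=z^2+z^{2^n-1}$, is an integral curve of degree $2^n$ that is rational over $K$. It has exactly one singular point in $\mathbb P^2(K)$. This point has multiplicity $2$ and is of type $A_m$, where $m=(2^n-1)(2^n-2)$. -/

import Mathlib

noncomputable section

namespace PlaneCurve

open MvPolynomial

variable {K : Type*} [Field K]

/-- The function field of the plane curve `F = 0` in the projective plane over `K`, where
`(F)` is a prime ideal: the subfield of the fraction field of the homogeneous coordinate ring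
`K[x, y, z] / (F)` generated over `K` by the quotients of the homogeneous coordinates. -/
def functionField (F : MvPolynomial (Fin 3) K) [(Ideal.span {F}).IsPrime] :
    IntermediateField K (FractionRing (MvPolynomial (Fin 3) K ⧸ Ideal.span {F})) :=
  IntermediateField.adjoin K
    {a | ∃ i j : Fin 3,
      a = algebraMap (MvPolynomial (Fin 3) K ⧸ Ideal.span {F}) _ (Ideal.Quotient.mk _ (X i)) /
          algebraMap (MvPolynomial (Fin 3) K ⧸ Ideal.span {F}) _ (Ideal.Quotient.mk _ (X j))}

/-- `F = 0` is an integral plane curve of degree `d` in the projective plane over `K`: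
`F` is an irreducible form of degree `d`. -/
def IsIntegralOfDegree (F : MvPolynomial (Fin 3) K) (d : ℕ) : Prop :=
  F.IsHomogeneous d ∧ Irreducible F

/-- The integral plane curve `F = 0` is rational over `K`: its function field is isomorphic,
over `K`, to the field of rational functions in one variable. -/
def IsRational (F : MvPolynomial (Fin 3) K) : Prop :=
  Irreducible F ∧ ∃ _ : (Ideal.span {F}).IsPrime, Nonempty (functionField F ≃ₐ[K] RatFunc K)

/-- `P` is a singular point of the plane curve `F = 0` (for a form `F`). -/
def IsSingularPoint (F : MvPolynomial (Fin 3) K) (P : Projectivization K (Fin 3 → K)) : Prop :=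
  eval P.rep F = 0 ∧ ∀ i, eval P.rep (pderiv i F) = 0

/-- The equation of `F = 0` in the standard affine chart in which the `i`-th homogeneous
coordinate is `1`, translated so that `P` becomes the origin, and viewed as a power series in
the two remaining coordinates (in increasing order). It is used for the `i` for which `P` lies in
that chart, that is, the `i`-th homogeneous coordinate of `P` is not zero. -/
def localEquation (F : MvPolynomial (Fin 3) K) (P : Projectivization K (Fin 3 → K)) (i : Fin 3) :
    MvPowerSeries (Fin 2) K :=
  ((aeval (i.insertNth (α := fun _ => MvPolynomial (Fin 2) K) 1
      (fun l => X l + C (P.rep (i.succAbove l) / P.rep i))) F : MvPolynomial (Fin 2) K) :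
    MvPowerSeries (Fin 2) K)

/-- The curve `F = 0` has multiplicity `e` at `P`: a local equation of it has order `e`. -/
def HasMultiplicity (F : MvPolynomial (Fin 3) K) (P : Projectivization K (Fin 3 → K)) (e : ℕ) :
    Prop :=
  ∀ i, P.rep i ≠ 0 → (localEquation F P i).order = e

/-- The curve `F = 0` is analytically irreducible over `K` at `P`. -/
def IsUnibranchAt (F : MvPolynomial (Fin 3) K) (P : Projectivization K (Fin 3 → K)) : Prop :=
  ∀ i, P.rep i ≠ 0 → Irreducible (localEquation F P i)

/-- Formal (contact) equivalence of two power series `f` and `g` in two variables: some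
automorphism of the power series ring takes the ideal `(f)` to the ideal `(g)`. -/
def FormallyEquivalent (f g : MvPowerSeries (Fin 2) K) : Prop :=
  ∃ φ : MvPowerSeries (Fin 2) K ≃ₐ[K] MvPowerSeries (Fin 2) K, Associated (φ f) g

/-- The singularity of `F = 0` at `P` is formally equivalent to that of `g = 0` at the origin. -/
def HasNormalFormAt (F : MvPolynomial (Fin 3) K) (P : Projectivization K (Fin 3 → K))
    (g : MvPowerSeries (Fin 2) K) : Prop :=
  ∀ i, P.rep i ≠ 0 → FormallyEquivalent (localEquation F P i) g

/-- The power series `z ^ 2 + x ^ (m + 1)`, where `x = X 0` and `z = X 1`. -/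
def formA0 (K : Type*) [Field K] (m : ℕ) : MvPowerSeries (Fin 2) K :=
  MvPowerSeries.X 1 ^ 2 + MvPowerSeries.X 0 ^ (m + 1)

/-- The power series `z ^ 2 + z x ^ r + x ^ (m + 1)`, where `x = X 0` and `z = X 1`. -/
def formA (K : Type*) [Field K] (m r : ℕ) : MvPowerSeries (Fin 2) K :=
  MvPowerSeries.X 1 ^ 2 + MvPowerSeries.X 1 * MvPowerSeries.X 0 ^ r + MvPowerSeries.X 0 ^ (m + 1)

/-- For an even number `m` and a perfect field `K` of characteristic 2: the singularity of `F = 0`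
at `P` is of type `A_m`. In characteristic 2 there are several formal equivalence classes of that
type; their normal forms are `z ^ 2 + x ^ (m + 1)` and `z ^ 2 + z x ^ r + x ^ (m + 1)`
with `m / 2 < r < m`. -/
def IsTypeAEven (F : MvPolynomial (Fin 3) K) (P : Projectivization K (Fin 3 → K)) (m : ℕ) : Prop :=
  Even m ∧ (HasNormalFormAt F P (formA0 K m) ∨
    ∃ r, m / 2 < r ∧ r < m ∧ HasNormalFormAt F P (formA K m r))

/-- The form `z ^ 2 y ^ q - (x ^ (q + 2) + x z ^ (q + 1))` with `q = 2 ^ n`, where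
`x = X 0`, `y = X 1`, `z = X 2`. -/
def curveC2 (K : Type*) [Field K] (n : ℕ) : MvPolynomial (Fin 3) K :=
  X 2 ^ 2 * X 1 ^ (2 ^ n) - (X 0 ^ (2 ^ n + 2) + X 0 * X 2 ^ (2 ^ n + 1))

/-- The form `y ^ q - (x ^ (q - 2) z ^ 2 + x z ^ (q - 1))` with `q = 2 ^ n`, where
`x = X 0`, `y = X 1`, `z = X 2` (used for `n ≥ 1`). Its affine equation, in the chart `x = 1`,
is `y ^ q = z ^ 2 + z ^ (q - 1)`. -/
def curveC (K : Type*) [Field K] (n : ℕ) : MvPolynomial (Fin 3) K :=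
  X 1 ^ (2 ^ n) - (X 0 ^ (2 ^ n - 2) * X 2 ^ 2 + X 0 * X 2 ^ (2 ^ n - 1))

end PlaneCurve

end

/-! Both curves are handled by one local computation and one parametrization argument. Put q = 2^n.

At the only singular point the local equation is z² + x^(2a) + x^ε z^(2k+1). Square terms can be
absorbed in characteristic 2: substitute z = Z + x^a s with s a polynomial in Y = x^e. Setting Z = 0
leaves x^(2a)(s² + 1 + Y^(2^l) s^(2k+1)), so s should make the bracket vanish to high order. The sum
s = ∑ Y^(2^l - 2^j) over j ≤ l does this, because s² + 1 + Y^(2^l) s telescopes to Y^(2^(l+1) - 1)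
(`telescopingSum_sq`), and replacing s by s^(2k+1) only multiplies the result by a unit. The
equation becomes u Z² + v Z x^r + w x^(m+1) with u, v, w units (`formallyEquivalent_formA_of_eq`).
Rescaling x, Z and the equation removes these units: this needs only a root of order e = 2r - (m+1),
which exists because e is odd and hence 1 in K (`formallyEquivalent_formA`). The normal form is
irreducible since m + 1 is odd and r > m/2, which gives the cusp.

Globally, each form is a binomial in y and Eisenstein at x applies. The parametrizations (t^q : t +
t^(q+2) : 1) and (1 : t² + t^(q-1) : t^q) give rationality once t lies in the function field; the
curve equation exhibits one square root after another, n times, until t is reached. One partial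
derivative locates the singular point. -/

noncomputable section

namespace PlaneCurve

/-! ### Automorphisms of power series rings tangent to the identity, and roots of 1-units. -/

section Substitution

open MvPowerSeries

variable {σ K : Type*} [Field K]

/-- `A` and `M` have order at least `n` and the same terms of degree `n`. -/
def AgreeTo (n : ℕ) (A M : MvPowerSeries σ K) : Prop :=
  ((n + 1 : ℕ) : ℕ∞) ≤ (A - M).order ∧ (n : ℕ∞) ≤ M.order

theorem AgreeTo.le_order {n : ℕ} {A M : MvPowerSeries σ K} (h : AgreeTo n A M) :
    (n : ℕ∞) ≤ A.order := by
  have h1 : (n : ℕ∞) ≤ (A - M).order := le_trans (by exact_mod_cast Nat.le_succ n) h.1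
  simpa using (le_min h1 h.2).trans (min_order_le_add (f := A - M) (g := M))

theorem AgreeTo.mul {n k : ℕ} {A M B N : MvPowerSeries σ K} (h : AgreeTo n A M)
    (h' : AgreeTo k B N) : AgreeTo (n + k) (A * B) (M * N) := by
  refine ⟨?_, ?_⟩
  · have e : A * B - M * N = (A - M) * B + M * (B - N) := by ring
    rw [e]
    refine le_trans (le_min ?_ ?_) min_order_le_add
    · refine le_trans ?_ ((add_le_add h.1 h'.le_order).trans le_order_mul)
      exact_mod_cast (by omega)
    · refine le_trans ?_ ((add_le_add h.2 h'.1).trans le_order_mul)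
      exact_mod_cast (by omega)
  · refine le_trans ?_ ((add_le_add h.2 h'.2).trans le_order_mul)
    exact_mod_cast le_rfl

theorem agreeTo_one : AgreeTo 0 (1 : MvPowerSeries σ K) 1 := by
  simp [AgreeTo]

theorem AgreeTo.pow {n : ℕ} {A M : MvPowerSeries σ K} (h : AgreeTo n A M) (k : ℕ) :
    AgreeTo (k * n) (A ^ k) (M ^ k) := by
  induction k with
  | zero => simpa using agreeTo_one
  | succ k ih => simpa [pow_succ, add_mul] using ih.mul h

theorem AgreeTo.prod {ι : Type*} (s : Finset ι) {n : ι → ℕ} {A M : ι → MvPowerSeries σ K}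
    (h : ∀ i ∈ s, AgreeTo (n i) (A i) (M i)) :
    AgreeTo (∑ i ∈ s, n i) (∏ i ∈ s, A i) (∏ i ∈ s, M i) := by
  classical
  induction s using Finset.induction_on with
  | empty => simpa using agreeTo_one
  | insert i s hi ih =>
    rw [Finset.sum_insert hi, Finset.prod_insert hi, Finset.prod_insert hi]
    exact (h i (Finset.mem_insert_self i s)).mul
      (ih fun j hj => h j (Finset.mem_insert_of_mem hj))

/-- Initial forms multiply, and each `a i` has initial form `X i`. -/
theorem agreeTo_prod_pow {a : σ → MvPowerSeries σ K}
    (ha : ∀ i, 2 ≤ (a i - X i).order) (d : σ →₀ ℕ) :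
    AgreeTo d.degree (d.prod fun i e => a i ^ e) (monomial d (1 : K)) := by
  have hX : monomial d (1 : K) = d.prod fun i e => (X i : MvPowerSeries σ K) ^ e := by
    have := subst_monomial (R := K) (HasSubst.X (σ := σ) (S := K)) d 1
    rw [subst_self] at this
    simpa using this
  rw [hX]
  have := AgreeTo.prod d.support (n := fun i => d i * 1) (A := fun i => a i ^ d i)
    (M := fun i => (X i : MvPowerSeries σ K) ^ d i) fun i _ => AgreeTo.pow ⟨ha i, by
      simpa using one_le_order_iff_constCoeff_eq_zero.mpr (constantCoeff_X (R := K) i)⟩ _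
  simpa [Finsupp.degree_apply, Finsupp.prod] using this

theorem hasSubst_of_two_le_order [Finite σ] {a : σ → MvPowerSeries σ K}
    (ha : ∀ i, 2 ≤ (a i - X i).order) : HasSubst a := by
  refine hasSubst_of_constantCoeff_zero fun i => ?_
  have h0 : coeff 0 (a i - X i) = 0 := coeff_of_lt_order (lt_of_lt_of_le (by simp) (ha i))
  simpa using h0

/-- If `a i` agrees with the variable `X i` up to terms of order two, then the substitution of
`a` fixes the leading terms of a power series. -/
theorem order_succ_le_order_subst_sub [Finite σ] {a : σ → MvPowerSeries σ K}
    (ha : ∀ i, 2 ≤ (a i - X i).order) (f : MvPowerSeries σ K) (D : ℕ) (hf : D ≤ f.order) :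
    ((D + 1 : ℕ) : ℕ∞) ≤ (subst a f - f).order := by
  classical
  refine nat_le_order fun e he => ?_
  rw [map_sub, sub_eq_zero, coeff_subst (hasSubst_of_two_le_order ha),
    finsum_eq_single _ e fun d hde => ?_]
  · by_cases hfe : coeff e f = 0
    · simp [hfe]
    have h := coeff_of_lt_order (d := e)
      (lt_of_lt_of_le (by exact_mod_cast Nat.lt_succ_self _) (agreeTo_prod_pow ha e).1)
    rw [map_sub, sub_eq_zero, coeff_monomial_same] at h
    simp [h]
  · by_cases hfd : coeff d f = 0
    · simp [hfd]
    have hd : D ≤ d.degree := by exact_mod_cast hf.trans (order_le hfd)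
    have h := coeff_of_lt_order (d := e)
      (lt_of_lt_of_le (by exact_mod_cast (by omega)) (agreeTo_prod_pow ha d).1)
    rw [map_sub, sub_eq_zero, coeff_monomial_ne hde.symm] at h
    simp [h]

/-- Power series whose linear parts are the variables define an automorphism of the power
series ring. -/
theorem exists_algEquiv_apply_X [Finite σ] {a : σ → MvPowerSeries σ K}
    (ha : ∀ i, 2 ≤ (a i - X i).order) :
    ∃ φ : MvPowerSeries σ K ≃ₐ[K] MvPowerSeries σ K, ∀ i, φ (X i) = a i := by
  have hs : HasSubst a := hasSubst_of_two_le_order ha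
  set ψ : MvPowerSeries σ K →ₐ[K] MvPowerSeries σ K := substAlgHom hs with hψ
  have key : ∀ (f : MvPowerSeries σ K) (D : ℕ), D ≤ f.order →
      ((D + 1 : ℕ) : ℕ∞) ≤ (f - ψ f).order := fun f D hf => by
    rw [← neg_sub, order_neg]
    simpa [hψ, coe_substAlgHom] using order_succ_le_order_subst_sub ha f D hf
  have hinj : Function.Injective ψ := by
    rw [injective_iff_map_eq_zero]
    intro f hf
    -- On the kernel f = f - ψ f, so every lower bound for the order improves by one.
    have : ∀ D : ℕ, D ≤ f.order := fun D => by
      induction D with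
      | zero => simp
      | succ D ih => simpa [hf] using key f D ih
    ext d
    exact coeff_of_lt_order (lt_of_lt_of_le (by exact_mod_cast Nat.lt_succ_self _)
      (this (d.degree + 1)))
  have hsurj : Function.Surjective ψ := by
    intro g
    -- N raises the order, so the geometric series ∑ N^k converges and inverts ψ = 1 - N.
    let N : MvPowerSeries σ K →ₗ[K] MvPowerSeries σ K := LinearMap.id - ψ.toLinearMap
    have hN : ∀ f, N f = f - ψ f := fun f => rfl
    have hNk : ∀ k : ℕ, (k : ℕ∞) ≤ ((N ^ k) g).order := fun k => by
      induction k with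
      | zero => simp
      | succ k ih => rw [pow_succ', Module.End.mul_apply, hN]; exact key _ _ ih
    let S : ℕ → MvPowerSeries σ K := fun D => ∑ k ∈ Finset.range (D + 1), (N ^ k) g
    have hS : ∀ D, ψ (S D) = g - (N ^ (D + 1)) g := fun D => by
      have h1 : ψ (S D) = S D - N (S D) := by rw [hN]; abel
      have h2 : N (S D) = ∑ k ∈ Finset.range (D + 1), (N ^ (k + 1)) g := by
        simp only [S, map_sum, pow_succ', Module.End.mul_apply]
      rw [h1, h2, ← Finset.sum_sub_distrib, Finset.sum_range_sub']
      simp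
    -- The limit of the partial sums: the coefficient at d no longer changes from `S d.degree` on.
    let f : MvPowerSeries σ K := fun d => coeff d (S d.degree)
    have hfS : ∀ D : ℕ, ((D + 1 : ℕ) : ℕ∞) ≤ (f - S D).order := fun D => by
      refine nat_le_order fun d hd => ?_
      have hle : d.degree ≤ D := by omega
      have hf : coeff d f = coeff d (S d.degree) := rfl
      rw [map_sub, hf, sub_eq_zero]
      simp only [S, map_sum]
      refine Finset.sum_subset (Finset.range_mono (by omega)) fun k _ hk => ?_
      refine coeff_of_lt_order (lt_of_lt_of_le ?_ (hNk k))
      simp only [Finset.mem_range] at hk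
      exact_mod_cast (by omega : d.degree < k)
    refine ⟨f, ?_⟩
    ext d
    have h1 : ψ f = g - (N ^ (d.degree + 1)) g + ((f - S d.degree) -
        ((f - S d.degree) - ψ (f - S d.degree))) := by
      rw [map_sub, hS]; abel
    have h2 : coeff d ((N ^ (d.degree + 1)) g) = 0 :=
      coeff_of_lt_order (lt_of_lt_of_le (by exact_mod_cast Nat.lt_succ_self _) (hNk _))
    have h3 : coeff d (f - S d.degree) = 0 :=
      coeff_of_lt_order (lt_of_lt_of_le (by exact_mod_cast Nat.lt_succ_self _) (hfS _))
    have h4 : coeff d ((f - S d.degree) - ψ (f - S d.degree)) = 0 :=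
      coeff_of_lt_order (lt_of_lt_of_le (by exact_mod_cast (by omega))
        (key _ _ (hfS d.degree)))
    rw [h1, map_add, map_sub _ g, h2, map_sub _ (f - S _), h3, h4, sub_zero, sub_zero, add_zero]
  exact ⟨AlgEquiv.ofBijective ψ ⟨hinj, hsurj⟩, fun i => by
    simp [hψ, subst_X hs]⟩

/-- A power series with constant coefficient `1` has an `e`-th root if `e = 1` in `K`. -/
theorem exists_pow_eq_of_constantCoeff_eq_one {e : ℕ} (he : (e : K) = 1)
    {h : MvPowerSeries σ K} (hh : constantCoeff h = 1) :
    ∃ ρ : MvPowerSeries σ K, ρ ^ e = h ∧ constantCoeff ρ = 1 := by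
  let x : MvPowerSeries Unit K := X ()
  obtain ⟨c, hc⟩ := Polynomial.powAddExpansion (1 : MvPowerSeries Unit K) x e
  have he' : (e : MvPowerSeries Unit K) = 1 := by
    rw [← map_natCast (C : K →+* MvPowerSeries Unit K), he, map_one]
  -- Since e = 1 in K, x ↦ (1 + x)^e - 1 is tangent to the identity. Its inverse gives an e-th root
  -- of 1 + x in one variable, into which h - 1 is then substituted.
  have ha : ∀ i : Unit, 2 ≤ ((fun _ => (1 + x) ^ e - 1) i - X i : MvPowerSeries Unit K).order := by
    intro i
    have : (1 + x) ^ e - 1 - X i = c * x ^ 2 := by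
      rw [hc, he']; simp only [one_pow, x]; ring
    simp only [this]
    refine le_trans ?_ le_order_mul
    refine le_trans ?_ (le_add_of_nonneg_left zero_le)
    exact le_order_pow_of_constantCoeff_eq_zero 2 (by simp [x])
  obtain ⟨φ, hφ⟩ := exists_algEquiv_apply_X ha
  set ξ := φ.symm x with hξ
  have h1 : (1 + ξ) ^ e = 1 + x := by
    apply φ.injective
    have h2 := hφ ()
    rw [map_pow, map_add, map_one, hξ, φ.apply_symm_apply, map_add, map_one, hφ ()]
    ring
  have h0 : constantCoeff ξ = 0 := by
    by_contra h0
    have hu : IsUnit ξ := by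
      rw [MvPowerSeries.isUnit_iff_constantCoeff]; exact isUnit_iff_ne_zero.mpr h0
    have hu' : IsUnit x := by simpa [hξ] using hu.map φ
    rw [MvPowerSeries.isUnit_iff_constantCoeff] at hu'
    simp [x] at hu'
  have hs : HasSubst (fun _ : Unit => h - 1) :=
    hasSubst_of_constantCoeff_zero fun _ => by simp [hh]
  refine ⟨substAlgHom hs (1 + ξ), ?_, ?_⟩
  · rw [← map_pow, h1, map_add, map_one]
    simp [x, subst_X hs]
  · rw [map_add, map_one, map_add, map_one, substAlgHom_apply,
      constantCoeff_subst_eq_zero hs (fun _ => by simp [hh]) h0, add_zero]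

end Substitution

/-! ### Reduction of the local equation to the normal form. -/

section NormalForm

/-- The sum `∑ Y ^ (2 ^ l - 2 ^ j)` for `j ≤ l`. -/
def telescopingSum {R : Type*} [CommRing R] (Y : R) (l : ℕ) : R :=
  ∑ j ∈ Finset.range (l + 1), Y ^ (2 ^ l - 2 ^ j)

/-- With G j = Y^(2^(l+1) - 2^j), squaring turns the j-th summand into G (j+1) and multiplying it by
Y^(2^l) gives G j. So only the two ends G (l+1) = 1 and G 0 survive. -/
theorem telescopingSum_sq {R : Type*} [CommRing R] [CharP R 2] (Y : R) (l : ℕ) :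
    telescopingSum Y l ^ 2 + 1 + Y ^ 2 ^ l * telescopingSum Y l = Y ^ (2 ^ (l + 1) - 1) := by
  let G : ℕ → R := fun j => Y ^ (2 ^ (l + 1) - 2 ^ j)
  have h1 : telescopingSum Y l ^ 2 = ∑ j ∈ Finset.range (l + 1), G (j + 1) := by
    rw [telescopingSum, CharTwo.sum_sq]
    refine Finset.sum_congr rfl fun j _ => ?_
    rw [← pow_mul]
    congr 1
    simp only [pow_succ]
    omega
  have h2 : Y ^ 2 ^ l * telescopingSum Y l = ∑ j ∈ Finset.range (l + 1), G j := by
    rw [telescopingSum, Finset.mul_sum]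
    refine Finset.sum_congr rfl fun j hj => ?_
    rw [← pow_add]
    congr 1
    have : 2 ^ j ≤ 2 ^ l :=
      Nat.pow_le_pow_right (by norm_num) (Nat.lt_succ_iff.mp (Finset.mem_range.mp hj))
    simp only [pow_succ]
    omega
  have h3 := Finset.sum_range_sub G (l + 1)
  rw [Finset.sum_sub_distrib, ← h1, ← h2] at h3
  have h4 : G (l + 1) = 1 := by simp [G]
  have h5 : G 0 = Y ^ (2 ^ (l + 1) - 1) := by simp [G]
  rw [h4, h5] at h3
  have two : (2 : R) = 0 := CharTwo.two_eq_zero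
  linear_combination h3 + (1 + Y ^ 2 ^ l * telescopingSum Y l - Y ^ (2 ^ (l + 1) - 1)) * two

/-- The error s^(2k+1) - s is a multiple of s² - 1, itself a multiple of Y^(2^l) by
`telescopingSum_sq`. After multiplication by Y^(2^l) it is divisible by Y^(2^(l+1)), one power of Y
beyond the main term. -/
theorem exists_telescopingSum_sq_add {R : Type*} [CommRing R] [CharP R 2] (Y : R) (l k : ℕ) :
    ∃ c, telescopingSum Y l ^ 2 + 1 + Y ^ 2 ^ l * telescopingSum Y l ^ (2 * k + 1) =
      Y ^ (2 ^ (l + 1) - 1) * (1 + Y * c) := by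
  set s := telescopingSum Y l with hs
  have h := telescopingSum_sq Y l
  rw [← hs] at h
  obtain ⟨b, hb⟩ := sub_dvd_pow_sub_pow (s ^ 2) 1 k
  have hpos : 1 ≤ 2 ^ l := Nat.one_le_two_pow
  have e1 : Y ^ (2 ^ (l + 1) - 1) = Y ^ 2 ^ l * Y ^ (2 ^ l - 1) := by
    rw [← pow_add]; congr 1; rw [pow_succ]; omega
  have e2 : Y ^ (2 ^ (l + 1) - 1) * Y = Y ^ 2 ^ l * Y ^ 2 ^ l := by
    rw [← pow_succ, ← pow_add]; congr 1; rw [pow_succ]; omega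
  have two : (2 : R) = 0 := CharTwo.two_eq_zero
  refine ⟨s * (Y ^ (2 ^ l - 1) - s) * b, ?_⟩
  have h3 : s ^ (2 * k + 1) = s + s * ((s ^ 2 - 1) * b) := by
    rw [← hb, pow_succ, pow_mul]; simp; ring
  have h4 : s ^ 2 - 1 = Y ^ 2 ^ l * (Y ^ (2 ^ l - 1) - s) := by
    linear_combination h - two + e1
  rw [h3, h4]
  linear_combination h - s * (Y ^ (2 ^ l - 1) - s) * b * e2

open MvPowerSeries

variable {K : Type*} [Field K]

theorem two_le_order_mul {σ : Type*} {f g : MvPowerSeries σ K} (hf : constantCoeff f = 0)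
    (hg : constantCoeff g = 0) : 2 ≤ (f * g).order := by
  refine le_trans ?_ le_order_mul
  rw [← one_add_one_eq_two]
  exact add_le_add (one_le_order_iff_constCoeff_eq_zero.mpr hf)
    (one_le_order_iff_constCoeff_eq_zero.mpr hg)

/-- A power series of the shape `u Z² + v Z x ^ r + w x ^ M` with units `u`, `v`, `w` is
equivalent to `z² + z x ^ r + x ^ M` if `2 r - M` is odd. -/
theorem formallyEquivalent_formA [CharP K 2] {f p u v w : MvPowerSeries (Fin 2) K} {m r e : ℕ}
    (he : Odd e) (hr : 2 * r = m + 1 + e) (hp : 2 ≤ p.order) (hu : constantCoeff u = 1)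
    (hv : constantCoeff v = 1) (hw : constantCoeff w = 1)
    (hf : f = (X 1 + p) ^ 2 * u + (X 1 + p) * X 0 ^ r * v + X 0 ^ (m + 1) * w) :
    FormallyEquivalent f (formA K m r) := by
  have unit_of : ∀ g : MvPowerSeries (Fin 2) K, constantCoeff g = 1 → IsUnit g := fun g hg => by
    rw [MvPowerSeries.isUnit_iff_constantCoeff, hg]; exact isUnit_one
  have he1 : (e : K) = 1 := by
    obtain ⟨j, rfl⟩ := he
    have two : (2 : K) = 0 := CharTwo.two_eq_zero
    push_cast
    linear_combination j * two
  obtain ⟨u, rfl⟩ := unit_of u hu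
  obtain ⟨v, rfl⟩ := unit_of v hv
  obtain ⟨w, rfl⟩ := unit_of w hw
  have hinv : ∀ g : (MvPowerSeries (Fin 2) K)ˣ, constantCoeff (g : MvPowerSeries (Fin 2) K) = 1 →
      constantCoeff (↑g⁻¹ : MvPowerSeries (Fin 2) K) = 1 := fun g hg => by
    have := congrArg constantCoeff g.mul_inv
    rwa [map_mul, hg, one_mul, map_one] at this
  -- Scaling x by ρ, Z by τ and the equation by c requires c τ² = u, c τ ρ^r = v and c ρ^(m+1) = w.
  -- Eliminating c and τ leaves ρ^(2r - m - 1) = v²/(u w).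
  obtain ⟨ρ, hρ, hρ1⟩ := exists_pow_eq_of_constantCoeff_eq_one he1
    (h := ((v ^ 2 * u⁻¹ * w⁻¹ : (MvPowerSeries (Fin 2) K)ˣ) : MvPowerSeries (Fin 2) K)) (by
      simp [hinv _ hu, hinv _ hw, hv])
  obtain ⟨ρ, rfl⟩ := unit_of ρ hρ1
  have hρe : ρ ^ e = v ^ 2 * u⁻¹ * w⁻¹ := Units.ext (by simpa using hρ)
  have hρr : (ρ ^ r) ^ 2 = ρ ^ (m + 1) * ρ ^ e := by
    rw [← pow_mul, ← pow_add, mul_comm r, hr]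
  let τ : (MvPowerSeries (Fin 2) K)ˣ := v * ρ ^ (m + 1) * w⁻¹ * (ρ ^ r)⁻¹
  let c : (MvPowerSeries (Fin 2) K)ˣ := w * (ρ ^ (m + 1))⁻¹
  have hτ : constantCoeff (τ : MvPowerSeries (Fin 2) K) = 1 := by
    have h1 : constantCoeff ((ρ ^ r : (MvPowerSeries (Fin 2) K)ˣ) : MvPowerSeries (Fin 2) K) = 1 := by
      simp [hρ1]
    have h2 := hinv _ h1
    simp only [τ, Units.val_mul, map_mul, hv, hinv _ hw, h2, Units.val_pow_eq_pow_val, map_pow, hρ1]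
    simp
  have c1 : c * τ ^ 2 = u := by
    have : τ ^ 2 = v ^ 2 * (ρ ^ (m + 1)) ^ 2 * (w⁻¹) ^ 2 * ((ρ ^ r) ^ 2)⁻¹ := by
      simp only [τ, mul_pow, inv_pow]
    rw [this, hρr, hρe]
    simp only [c, pow_two]
    generalize ρ ^ (m + 1) = t
    apply Additive.ofMul.injective
    simp only [ofMul_mul, ofMul_inv]
    abel
  have c2 : c * τ * ρ ^ r = v := by
    simp only [c, τ]
    generalize ρ ^ (m + 1) = t
    generalize ρ ^ r = t'
    apply Additive.ofMul.injective
    simp only [ofMul_mul, ofMul_inv]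
    abel
  have c3 : c * ρ ^ (m + 1) = w := by simp [c]
  let a : Fin 2 → MvPowerSeries (Fin 2) K :=
    ![X 0 * (ρ : MvPowerSeries (Fin 2) K), (X 1 + p) * (τ : MvPowerSeries (Fin 2) K)]
  have hp0 : constantCoeff p = 0 :=
    one_le_order_iff_constCoeff_eq_zero.mp (le_trans (by norm_num) hp)
  have ha : ∀ i, 2 ≤ (a i - X i).order := by
    rw [Fin.forall_fin_two]
    constructor
    · have : a 0 - X 0 = X 0 * ((ρ : MvPowerSeries (Fin 2) K) - 1) := by simp [a]; ring
      rw [this]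
      exact two_le_order_mul (by simp) (by simp [hρ1])
    · have : a 1 - X 1 = (X 1 + p) * ((τ : MvPowerSeries (Fin 2) K) - 1) + p := by simp [a]; ring
      rw [this]
      refine le_trans (le_min ?_ hp) min_order_le_add
      exact two_le_order_mul (by simp [hp0]) (by simp [hτ])
  obtain ⟨φ, hφ⟩ := exists_algEquiv_apply_X ha
  refine ⟨φ.symm, ?_⟩
  have key : f = c * φ (formA K m r) := by
    have d1 := congrArg Units.val c1
    have d2 := congrArg Units.val c2
    have d3 := congrArg Units.val c3
    push_cast at d1 d2 d3
    simp only [formA, map_add, map_mul, map_pow, hφ, a, Matrix.cons_val_zero, Matrix.cons_val_one]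
    rw [hf, ← d1, ← d2, ← d3]
    ring
  rw [key, map_mul, φ.symm_apply_apply]
  exact associated_unit_mul_left _ _ (c.isUnit.map φ.symm)

/-- Along z = x^a s, hypothesis `h1` says that x^ε z^(2k+1) has order e·2^l more than x^(2a), so
x^(2a) times the polynomial of `exists_telescopingSum_sq_add` in Y = x^e appears. The linear term in
Z = z + x^a s comes from x^ε z^(2k+1), which explains r. The bound 2 ≤ a keeps the shift x^a s out
of the linear part. -/
theorem formallyEquivalent_formA_of_eq [CharP K 2] {l k a ε e m r : ℕ}
    (ha : 2 ≤ a) (he : Odd e) (h1 : ε + a * (2 * k + 1) = 2 * a + e * 2 ^ l)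
    (hr : r = ε + 2 * a * k) (hm : m + 1 = 2 * a + e * (2 ^ (l + 1) - 1)) :
    FormallyEquivalent (X 1 ^ 2 + X 0 ^ (2 * a) + X 0 ^ ε * X 1 ^ (2 * k + 1)) (formA K m r) := by
  have : CharP (MvPowerSeries (Fin 2) K) 2 := by
    refine (CharP.charP_iff_prime_eq_zero Nat.prime_two).mpr ?_
    rw [← map_natCast (C : K →+* MvPowerSeries (Fin 2) K), CharP.cast_eq_zero, map_zero]
  have two : (2 : MvPowerSeries (Fin 2) K) = 0 := CharTwo.two_eq_zero
  set x : MvPowerSeries (Fin 2) K := X 0 with hx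
  set z : MvPowerSeries (Fin 2) K := X 1 with hz
  obtain ⟨c, hc⟩ := exists_telescopingSum_sq_add (x ^ e) l k
  have hs := congrArg constantCoeff (telescopingSum_sq (x ^ e) l)
  set s := telescopingSum (x ^ e) l
  have he0 : e ≠ 0 := by rintro rfl; simp at he
  have hpos : 2 ≤ 2 ^ (l + 1) := by
    rw [pow_succ]; have : 1 ≤ 2 ^ l := Nat.one_le_two_pow
    omega
  -- At x = 0 the telescoping identity reads s² + 1 = 0, that is, (s - 1)² = 0.
  have hs1 : constantCoeff s = 1 := by
    have hq : 2 ^ (l + 1) - 1 ≠ 0 := by omega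
    simp only [map_add, map_mul, map_pow, map_one, hx, constantCoeff_X, zero_pow he0,
      zero_pow hq, zero_pow (pow_ne_zero l two_ne_zero), zero_mul, add_zero] at hs
    have two' : (2 : K) = 0 := CharTwo.two_eq_zero
    have : (constantCoeff s - 1) ^ 2 = 0 := by linear_combination hs - constantCoeff s * two'
    exact sub_eq_zero.mp (pow_eq_zero_iff two_ne_zero |>.mp this)
  -- In characteristic 2, z² - (x^a s)² = Z². So z^(2k) is (x^a s)^(2k) plus Z² d, and the Z² part
  -- goes into the unit u.
  obtain ⟨d, hd⟩ := sub_dvd_pow_sub_pow (z ^ 2) ((x ^ a * s) ^ 2) k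
  have hq1 : 2 ^ (l + 1) - 1 + 1 = 2 ^ (l + 1) := by omega
  have hxp : x ^ ε * x ^ (a * (2 * k + 1)) = x ^ (2 * a) * (x ^ e) ^ 2 ^ l := by
    rw [← pow_add, h1, pow_add, pow_mul x e]
  have hxm : x ^ (m + 1) = x ^ (2 * a) * (x ^ e) ^ (2 ^ (l + 1) - 1) := by
    rw [hm, pow_add, pow_mul x e]
  have hxr : x ^ r = x ^ ε * x ^ (2 * a * k) := by rw [hr, pow_add]
  refine formallyEquivalent_formA (p := x ^ a * s) (u := 1 + x ^ ε * d * z) (v := s ^ (2 * k))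
    (w := 1 + x ^ e * c) he ?_ ?_ ?_ ?_ ?_ ?_
  · rw [hm, hr]
    have h : e * (2 ^ (l + 1) - 1) + e = 2 * (e * 2 ^ l) := by
      rw [← Nat.mul_succ, Nat.succ_eq_add_one, hq1, pow_succ]; ring
    linarith
  · refine le_trans (le_trans ?_ (le_order_pow_of_constantCoeff_eq_zero a
      (constantCoeff_X (R := K) (0 : Fin 2)))) (le_trans le_self_add le_order_mul)
    exact_mod_cast ha
  · simp [hz]
  · simp [hs1]
  · simp [hx, he0]
  · rw [← hx, ← hz, hxm, hxr]
    have h2 : z ^ (2 * k + 1) = (((x ^ a * s) ^ 2) ^ k + (z ^ 2 - (x ^ a * s) ^ 2) * d) * z := by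
      rw [← hd, pow_succ, pow_mul]; ring
    have h3 : x ^ ε * (x ^ a * s) ^ (2 * k + 1) =
        x ^ (2 * a) * (x ^ e) ^ 2 ^ l * s ^ (2 * k + 1) := by
      rw [mul_pow, ← mul_assoc, ← pow_mul, hxp]
    have h4 : x ^ (2 * a * k) * s ^ (2 * k) = ((x ^ a * s) ^ 2) ^ k := by
      ring
    have h5 : (x ^ a * s) ^ (2 * k + 1) = ((x ^ a * s) ^ 2) ^ k * (x ^ a * s) := by
      rw [pow_succ, pow_mul]
    have h6 : (x ^ a * s) ^ 2 = x ^ (2 * a) * s ^ 2 := by ring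
    rw [h5] at h3
    rw [h2]
    generalize x ^ a * s = P at *
    linear_combination -(z + P) * x ^ ε * h4 + x ^ (2 * a) * hc - h3 - h6 -
      (x ^ (2 * a) * (x ^ e) ^ 2 ^ l * s ^ (2 * k + 1) + x ^ (2 * a) * s ^ 2 + z * P +
        (P ^ 2 + z * P) * x ^ ε * d * z) * two

end NormalForm

/-! ### Analytic irreducibility of the normal form. -/

section Irreducible

open MvPowerSeries Finset

variable {K : Type*} [Field K]

/-- The coefficient of `x ^ i z ^ j`. -/
def coeffXZ (i j : ℕ) (f : MvPowerSeries (Fin 2) K) : K :=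
  coeff (Finsupp.single 0 i + Finsupp.single 1 j) f

theorem coeffXZ_mul (i j : ℕ) (f g : MvPowerSeries (Fin 2) K) :
    coeffXZ i j (f * g) = ∑ p ∈ antidiagonal i, ∑ q ∈ antidiagonal j,
      coeffXZ p.1 q.1 f * coeffXZ p.2 q.2 g := by
  classical
  have hfin : ∀ d : Fin 2 →₀ ℕ, Finsupp.single 0 (d 0) + Finsupp.single 1 (d 1) = d := fun d => by
    ext i; fin_cases i <;> simp
  rw [coeffXZ, coeff_mul, ← sum_product']
  refine sum_nbij' (fun P => ((P.1 0, P.2 0), (P.1 1, P.2 1)))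
    (fun P => (Finsupp.single 0 P.1.1 + Finsupp.single 1 P.2.1,
      Finsupp.single 0 P.1.2 + Finsupp.single 1 P.2.2)) ?_ ?_ ?_ ?_ ?_
  · intro P hP
    rw [HasAntidiagonal.mem_antidiagonal] at hP
    have h0 := DFunLike.congr_fun hP 0
    have h1 := DFunLike.congr_fun hP 1
    simp at h0 h1
    simp [h0, h1]
  · intro P hP
    simp only [mem_product, HasAntidiagonal.mem_antidiagonal] at hP ⊢
    rw [← hP.1, ← hP.2]
    simp only [Finsupp.single_add]
    abel
  · intro P _
    simp only [hfin]
  · intro P _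
    simp
  · intro P _
    simp only [coeffXZ, hfin]

theorem coeffXZ_X_pow_mul_X_pow (i j a b : ℕ) :
    coeffXZ i j ((X 0 ^ a * X 1 ^ b : MvPowerSeries (Fin 2) K)) =
      if i = a ∧ j = b then 1 else 0 := by
  classical
  rw [coeffXZ, X_pow_eq, X_pow_eq, monomial_mul_monomial, coeff_monomial, one_mul]
  refine if_congr ⟨fun h => ?_, fun h => by rw [h.1, h.2]⟩ rfl rfl
  have h0 := DFunLike.congr_fun h 0
  have h1 := DFunLike.congr_fun h 1
  simpa using And.intro h0 h1

theorem coeffXZ_formA (m r i j : ℕ) :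
    coeffXZ i j (formA K m r) = (if i = 0 ∧ j = 2 then 1 else 0) +
      (if i = r ∧ j = 1 then 1 else 0) + (if i = m + 1 ∧ j = 0 then 1 else 0) := by
  rw [← coeffXZ_X_pow_mul_X_pow i j 0 2, ← coeffXZ_X_pow_mul_X_pow i j r 1,
    ← coeffXZ_X_pow_mul_X_pow i j (m + 1) 0]
  simp only [coeffXZ, ← map_add, formA, pow_zero, one_mul, mul_one, pow_one]
  rw [mul_comm (X 1)]

theorem coeffXZ_zero_zero (f : MvPowerSeries (Fin 2) K) : coeffXZ 0 0 f = constantCoeff f := by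
  simp [coeffXZ]

/-- If `g h` is the normal form, then the order of `g` along `z = 0` cannot be smaller than
the order of `h`. -/
theorem not_lt_of_mul_eq_formA {m r a b : ℕ} {g h : MvPowerSeries (Fin 2) K} (hr : m / 2 < r)
    (hgh : g * h = formA K m r) (hg0 : coeffXZ 0 0 g = 0) (hh0 : coeffXZ 0 0 h = 0)
    (hga : coeffXZ a 0 g ≠ 0) (hgi : ∀ i < a, coeffXZ i 0 g = 0)
    (hhi : ∀ i < b, coeffXZ i 0 h = 0) (hab : a + b = m + 1) : ¬ a < b := by
  intro hlt
  -- If a < b then a ≤ m/2 < r, so the normal form has no x^a z term. This forces the z-coefficient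
  -- of h to vanish, whereas the coefficient 1 of z² needs it nonzero.
  have h1 : coeffXZ a 1 (g * h) = coeffXZ a 0 g * coeffXZ 0 1 h := by
    rw [coeffXZ_mul, sum_eq_single (a, 0)]
    · simp [Nat.antidiagonal_succ, hhi 0 (by omega)]
    · rintro ⟨i, i'⟩ hi hne
      have hi' : i + i' = a := HasAntidiagonal.mem_antidiagonal.mp hi
      have : i < a := lt_of_le_of_ne (by omega) fun h => hne (by
        subst h; simp; omega)
      simp [Nat.antidiagonal_succ, hgi i this, hhi i' (by omega)]
    · simp
  have h2 : coeffXZ 0 2 (g * h) = coeffXZ 0 1 g * coeffXZ 0 1 h := by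
    rw [coeffXZ_mul]
    simp [Nat.antidiagonal_succ, hg0, hh0]
  rw [hgh, coeffXZ_formA] at h1 h2
  have ha : a ≠ r := by omega
  simp [ha] at h1 h2
  rcases h1 with h1 | h1
  · exact hga h1
  · simp [h1] at h2

/-- On z = 0 a factorization becomes one of x^(m+1), so the orders a and b of the factors sum to the
odd number m + 1. They differ, and `not_lt_of_mul_eq_formA` excludes either being smaller. -/
theorem irreducible_formA {m r : ℕ} (hm : Even m) (hr : m / 2 < r) :
    Irreducible (formA K m r) := by
  have hnu : ∀ f : MvPowerSeries (Fin 2) K, ¬ IsUnit f ↔ coeffXZ 0 0 f = 0 := fun f => by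
    rw [MvPowerSeries.isUnit_iff_constantCoeff, isUnit_iff_ne_zero, not_not, coeffXZ_zero_zero]
  refine ⟨(hnu _).mpr (by simp [coeffXZ_formA]), ?_⟩
  intro g h hgh
  by_contra hcon
  rw [not_or, hnu, hnu] at hcon
  obtain ⟨hg0, hh0⟩ := hcon
  have hmul : ∀ i, coeffXZ i 0 (formA K m r) =
      ∑ p ∈ antidiagonal i, coeffXZ p.1 0 g * coeffXZ p.2 0 h := fun i => by
    rw [hgh, coeffXZ_mul]; simp
  have hne : coeffXZ (m + 1) 0 (formA K m r) ≠ 0 := by simp [coeffXZ_formA]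
  rw [hmul] at hne
  obtain ⟨p, -, hp⟩ := exists_ne_zero_of_sum_ne_zero hne
  classical
  have hga : ∃ a, coeffXZ a 0 g ≠ 0 := ⟨_, left_ne_zero_of_mul hp⟩
  have hhb : ∃ b, coeffXZ b 0 h ≠ 0 := ⟨_, right_ne_zero_of_mul hp⟩
  set a := Nat.find hga with ha
  set b := Nat.find hhb with hb
  have hgi : ∀ i < a, coeffXZ i 0 g = 0 := fun i hi => not_not.mp (Nat.find_min hga hi)
  have hhi : ∀ i < b, coeffXZ i 0 h = 0 := fun i hi => not_not.mp (Nat.find_min hhb hi)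
  have hab : a + b = m + 1 := by
    have h1 := hmul (a + b)
    rw [sum_eq_single (a, b)] at h1
    · have h2 := mul_ne_zero (Nat.find_spec hga) (Nat.find_spec hhb)
      rw [← ha, ← hb, ← h1, coeffXZ_formA] at h2
      by_contra h3
      simp [h3] at h2
    · rintro ⟨i, j⟩ hij hne
      have hij' : i + j = a + b := HasAntidiagonal.mem_antidiagonal.mp hij
      rcases lt_trichotomy i a with h | h | h
      · simp [hgi i h]
      · exact absurd (by ext <;> simp <;> omega) hne
      · simp [hhi j (by omega)]
    · simp
  have := not_lt_of_mul_eq_formA hr hgh.symm hg0 hh0 (Nat.find_spec hga) hgi hhi hab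
  have := not_lt_of_mul_eq_formA hr (by rw [hgh, mul_comm]) hh0 hg0 (Nat.find_spec hhb) hhi hgi
    (by omega)
  obtain ⟨c, hc⟩ := hm
  omega

theorem FormallyEquivalent.irreducible {f g : MvPowerSeries (Fin 2) K}
    (h : FormallyEquivalent f g) (hg : Irreducible g) : Irreducible f := by
  obtain ⟨φ, hφ⟩ := h
  exact (MulEquiv.irreducible_iff φ).mp (hφ.irreducible_iff.mpr hg)

end Irreducible

/-! ### Eisenstein's criterion for binomials that need not be monic. -/

section Eisenstein

open Polynomial

/-- Eisenstein's criterion for a binomial. -/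
theorem irreducible_C_mul_X_pow_sub_C {R : Type*} [CommRing R] [IsDomain R] {x a b : R}
    (hx : Prime x) (ha : ¬ x ∣ a) (hb : ¬ x ∣ b) (hrel : IsRelPrime a (x * b)) {n : ℕ}
    (hn : n ≠ 0) : Irreducible (C a * X ^ n - C (x * b) : R[X]) := by
  have ha0 : a ≠ 0 := by rintro rfl; exact ha (dvd_zero x)
  have hdeg : (C a * X ^ n - C (x * b) : R[X]).natDegree = n := by
    rw [natDegree_sub_C, natDegree_C_mul_X_pow n a ha0]
  have hcoeff : ∀ i, i ≠ 0 → (C a * X ^ n - C (x * b) : R[X]).coeff i = if i = n then a else 0 :=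
    fun i hi => by rw [coeff_sub, coeff_C_mul_X_pow, coeff_C_of_ne_zero hi, sub_zero]
  have hzero : (C a * X ^ n - C (x * b) : R[X]).coeff 0 = -(x * b) := by
    simp [hn.symm]
  have hprim : (Ideal.span {x}).IsPrime := (Ideal.span_singleton_prime hx.ne_zero).mpr hx
  refine irreducible_of_eisenstein_criterion hprim ?_ ?_ ?_ ?_ ?_
  · rw [leadingCoeff, hdeg, hcoeff n hn, if_pos rfl, Ideal.mem_span_singleton]
    exact ha
  · intro i hi
    rw [Ideal.mem_span_singleton]
    have hin : i ≠ n := by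
      have := coe_lt_degree.mp hi
      rw [hdeg] at this
      exact this.ne
    rcases eq_or_ne i 0 with rfl | h0
    · rw [hzero]
      exact (dvd_mul_right x b).neg_right
    · rw [hcoeff i h0, if_neg hin]
      exact dvd_zero x
  · exact natDegree_pos_iff_degree_pos.mp (by rw [hdeg]; exact Nat.pos_of_ne_zero hn)
  · rw [hzero, Ideal.span_singleton_pow, Ideal.mem_span_singleton, dvd_neg, pow_two]
    exact fun h => hb ((mul_dvd_mul_iff_left hx.ne_zero).mp h)
  · intro r hr
    rw [C_dvd_iff_dvd_coeff] at hr
    refine hrel ?_ ?_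
    · have := hr n
      rwa [hcoeff n hn, if_pos rfl] at this
    · have := hr 0
      rwa [hzero, dvd_neg] at this

end Eisenstein

/-! ### Rationality from a polynomial parametrization. -/

section Rational

open MvPolynomial

universe u

variable {K : Type u} [Field K]

theorem aeval_mul_of_isHomogeneous {σ A : Type*} [CommRing A] [Algebra K A]
    {F : MvPolynomial σ K} {d : ℕ} (hF : F.IsHomogeneous d) (a : A) (x : σ → A) :
    aeval (fun i => a * x i) F = a ^ d * aeval x F := by
  rw [aeval_def, aeval_def, eval₂_eq, eval₂_eq, Finset.mul_sum]
  refine Finset.sum_congr rfl fun m hm => ?_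
  have hd : ∑ i ∈ m.support, m i = d := by
    have := hF (mem_support_iff.mp hm)
    simpa [Finsupp.weight_apply, Finsupp.sum] using this
  simp only [mul_pow, Finset.prod_mul_distrib, Finset.prod_pow_eq_pow_sum, hd]
  ring

/-- A plane curve is rational if it has a polynomial parametrization whose parameter can be
recovered rationally. -/
theorem isRational_of_parametrization {F : MvPolynomial (Fin 3) K} {d : ℕ}
    (hd : F.IsHomogeneous d) (hF : Irreducible F) (c i₀ : Fin 3) (p : Fin 3 → Polynomial K)
    (hc : p c = 1) (hi₀ : Transcendental K (p i₀)) (hp : aeval p F = 0)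
    (ht : ∀ (L : Type u) [Field L] [Algebra K L] (x : Fin 3 → L), x c = 1 → aeval x F = 0 →
      ∃ t : L, ∀ i, x i = Polynomial.aeval t (p i)) :
    IsRational F := by
  have hprime : (Ideal.span {F}).IsPrime :=
    (Ideal.span_singleton_prime hF.ne_zero).mpr hF.prime
  refine ⟨hF, hprime, ?_⟩
  let A := MvPolynomial (Fin 3) K ⧸ Ideal.span {F}
  let Q := FractionRing A
  let ev : A →ₐ[K] Polynomial K := Ideal.Quotient.liftₐ (Ideal.span {F}) (aeval p) fun a ha => by
    obtain ⟨b, rfl⟩ := Ideal.mem_span_singleton.mp ha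
    rw [map_mul, hp, zero_mul]
  let x : Fin 3 → A := fun i => Ideal.Quotient.mk _ (X i)
  have hev : ∀ i, ev (x i) = p i := fun i => by
    simp only [ev, x]
    erw [Ideal.Quotient.lift_mk]
    simp
  have hxc : x c ≠ 0 := fun h => by
    have := hev c
    rw [h, map_zero, hc] at this
    exact zero_ne_one this
  have hinj : Function.Injective (algebraMap A Q) := IsFractionRing.injective A Q
  have hxcQ : algebraMap A Q (x c) ≠ 0 := by
    rwa [Ne, map_eq_zero_iff _ hinj]
  let L := functionField F
  have hmem : ∀ i j, algebraMap A Q (x i) / algebraMap A Q (x j) ∈ L := fun i j =>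
    IntermediateField.subset_adjoin K _ ⟨i, j, rfl⟩
  -- The generic point of the curve, in the chart where coordinate c is 1; `ht` applied to it yields
  -- the generator t.
  let y : Fin 3 → L := fun i => ⟨_, hmem i c⟩
  have hyF : aeval y F = 0 := by
    have h1 : (L.val (aeval y F) : Q) = aeval (fun i => L.val (y i)) F := by
      rw [← MvPolynomial.comp_aeval_apply]
    have h2 : (fun i => L.val (y i)) = fun i => (algebraMap A Q (x c))⁻¹ * algebraMap A Q (x i) := by
      funext i
      rw [mul_comm, ← div_eq_mul_inv]
      rfl
    have h3 : aeval (fun i => algebraMap A Q (x i)) F = algebraMap A Q (aeval x F) := by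
      rw [← aeval_algebraMap_apply]
      rfl
    have h4 : aeval x F = 0 := by
      have : aeval x = Ideal.Quotient.mkₐ K (Ideal.span {F}) := by
        ext i; rw [aeval_X]; rfl
      rw [this]
      exact Ideal.Quotient.eq_zero_iff_mem.mpr (Ideal.mem_span_singleton_self F)
    rw [h2, aeval_mul_of_isHomogeneous hd, h3, h4, map_zero, mul_zero] at h1
    exact (map_eq_zero_iff _ L.val.injective).mp h1
  obtain ⟨t, hty⟩ := ht L y (Subtype.ext (div_self hxcQ)) hyF
  have hyQ : ∀ i, algebraMap A Q (x i) / algebraMap A Q (x c) =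
      Polynomial.aeval (t : Q) (p i) := fun i => by
    have := congrArg L.val (hty i)
    rw [← Polynomial.aeval_algHom_apply] at this
    exact this
  -- It is enough that p i₀ at t, i.e. x i₀ / x c, is transcendental. Clearing denominators in a
  -- relation for it and applying the parametrization `ev`, which sends x c to 1, would give a
  -- relation for p i₀.
  have htr : Transcendental K (t : Q) := by
    refine ((transcendental_aeval_iff (f := p i₀)).mp ?_).1
    rw [← hyQ, transcendental_iff]
    intro G hG
    by_contra hG0
    have h1 : Polynomial.aeval (algebraMap A Q (x i₀))
        ((G.map (algebraMap K A)).scaleRoots (x c)) = 0 :=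
      Polynomial.scaleRoots_aeval_eq_zero_of_aeval_div_eq_zero hinj
        (by rw [Polynomial.aeval_map_algebraMap]; exact hG) (mem_nonZeroDivisors_of_ne_zero hxc)
    rw [Polynomial.aeval_algebraMap_apply, map_eq_zero_iff _ hinj] at h1
    have h2 := congrArg ev h1
    have h3 : (ev : A →+* Polynomial K).comp (algebraMap K A) =
        algebraMap K (Polynomial K) := ev.comp_algebraMap
    have h4 : (ev : A →+* Polynomial K) (G.map (algebraMap K A)).leadingCoeff ≠ 0 := by
      rw [Polynomial.leadingCoeff_map, ← RingHom.comp_apply, h3]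
      simpa using hG0
    rw [map_zero, Polynomial.coe_aeval_eq_eval, ← RingHom.coe_coe, ← Polynomial.eval₂_at_apply,
      ← Polynomial.eval_map, Polynomial.map_scaleRoots _ _ _ h4, Polynomial.map_map, h3,
      RingHom.coe_coe, hev, hev, hc, Polynomial.scaleRoots_one, Polynomial.eval_map_algebraMap] at h2
    exact hG0 (transcendental_iff.mp hi₀ G h2)
  have hL : L = IntermediateField.adjoin K {(t : Q)} := by
    refine le_antisymm ?_ ?_
    · refine IntermediateField.adjoin_le_iff.mpr ?_
      have hmem' : ∀ i, algebraMap A Q (x i) / algebraMap A Q (x c) ∈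
          IntermediateField.adjoin K {(t : Q)} := fun i => by
        rw [hyQ]
        exact IntermediateField.algebra_adjoin_le_adjoin K _
          (Polynomial.aeval_mem_adjoin_singleton K _)
      rintro _ ⟨i, j, rfl⟩
      have := div_mem (hmem' i) (hmem' j)
      rwa [div_div_div_cancel_right₀ hxcQ] at this
    · rw [IntermediateField.adjoin_simple_le_iff]
      exact t.2
  exact ⟨(IntermediateField.equivOfEq hL).trans (RatFunc.algEquivOfTranscendental _ htr).symm⟩

end Rational

/-! ### Recovering the parameter by repeated square roots. -/

section Parameter

variable {L : Type*} [Field L] [CharP L 2]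

theorem exists_pow_eq_and_eq_add_pow (N l : ℕ) (a b : L) (h : b ^ 2 ^ l = a + a ^ (2 * N)) :
    ∃ t, t ^ 2 ^ l = a ∧ b = t + t ^ (2 * N) := by
  have two : (2 : L) = 0 := CharTwo.two_eq_zero
  induction l generalizing a with
  | zero => exact ⟨a, by simp, by simpa using h⟩
  | succ l ih =>
    rw [pow_succ, pow_mul] at h
    -- The equation writes a as a square. Its root s satisfies s^(2N) = a^N, hence the same equation
    -- with l in place of l + 1.
    have hs : (b ^ 2 ^ l + a ^ N) ^ 2 = a := by
      linear_combination h + (b ^ 2 ^ l * a ^ N + a ^ (2 * N)) * two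
    obtain ⟨t, ht, hb⟩ := ih (b ^ 2 ^ l + a ^ N) (by
      rw [pow_mul, hs]; linear_combination -a ^ N * two)
    exact ⟨t, by rw [pow_succ, pow_mul, ht, hs], hb⟩

theorem exists_pow_eq_and_eq_sq_add_pow (N l : ℕ) (a b : L)
    (h : b ^ 2 ^ l = a ^ 2 + a ^ (2 * N + 1)) :
    ∃ t, t ^ 2 ^ l = a ∧ b = t ^ 2 + t ^ (2 * N + 1) := by
  have two : (2 : L) = 0 := CharTwo.two_eq_zero
  induction l generalizing a with
  | zero => exact ⟨a, by simp, by simpa using h⟩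
  | succ l ih =>
    rw [pow_succ, pow_mul] at h
    obtain ⟨s, hs, hb⟩ : ∃ s, s ^ 2 = a ∧ b ^ 2 ^ l = s ^ 2 + s ^ (2 * N + 1) := by
      rcases eq_or_ne a 0 with rfl | ha
      · exact ⟨0, by simp, by simpa using h⟩
      · have haN : a ^ N ≠ 0 := pow_ne_zero N ha
        -- Here a · (a^N)² = (b^(2^l) + a)², so a is a square once a^N is invertible.
        have hs : ((b ^ 2 ^ l + a) / a ^ N) ^ 2 = a := by
          rw [div_pow, div_eq_iff (pow_ne_zero 2 haN)]
          linear_combination h + (b ^ 2 ^ l * a + a ^ 2) * two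
        refine ⟨(b ^ 2 ^ l + a) / a ^ N, hs, ?_⟩
        rw [pow_succ _ (2 * N), pow_mul, hs, mul_div_cancel₀ _ haN]
        linear_combination -a * two
    obtain ⟨t, ht, hb⟩ := ih s hb
    exact ⟨t, by rw [pow_succ, pow_mul, ht, hs], hb⟩

end Parameter

/-! ### Orders of local equations, and coordinate points of the plane. -/

section Local

open MvPowerSeries

variable {K : Type*} [Field K]

theorem order_X_pow_mul_X_pow {σ : Type*} (i j : σ) (a b : ℕ) :
    ((a + b : ℕ) : ℕ∞) ≤ (X i ^ a * X j ^ b : MvPowerSeries σ K).order := by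
  rw [Nat.cast_add]
  refine le_trans (add_le_add ?_ ?_) le_order_mul <;>
  exact le_order_pow_of_constantCoeff_eq_zero _ (constantCoeff_X _)

theorem order_eq_two {a ε k : ℕ} (ha : 2 ≤ a) (hk : 1 ≤ k) :
    (X 1 ^ 2 + X 0 ^ (2 * a) + X 0 ^ ε * X 1 ^ (2 * k + 1) :
      MvPowerSeries (Fin 2) K).order = 2 := by
  have h1 : (X 1 ^ 2 : MvPowerSeries (Fin 2) K).order = 2 := by
    rw [X_pow_eq, order_monomial_of_ne_zero one_ne_zero]
    simp
  have h2 : (3 : ℕ∞) ≤ (X 0 ^ (2 * a) + X 0 ^ ε * X 1 ^ (2 * k + 1) :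
      MvPowerSeries (Fin 2) K).order := by
    refine le_trans (le_min ?_ ?_) min_order_le_add
    · have := order_X_pow_mul_X_pow (K := K) (0 : Fin 2) 1 (2 * a) 0
      rw [pow_zero, mul_one] at this
      exact le_trans (by exact_mod_cast (by omega)) this
    · exact le_trans (by exact_mod_cast (by omega)) (order_X_pow_mul_X_pow (0 : Fin 2) 1 _ _)
  have h3 : (2 : ℕ∞) < 3 := by norm_num
  rw [add_assoc, order_add_of_order_ne (by rw [h1]; exact (h3.trans_le h2).ne), h1]
  exact min_eq_left (h3.trans_le h2).le

theorem rep_mk_single {i j : Fin 3} {h : (Pi.single i 1 : Fin 3 → K) ≠ 0} :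
    (Projectivization.mk K (Pi.single i 1 : Fin 3 → K) h).rep j ≠ 0 ↔ j = i := by
  obtain ⟨a, ha⟩ := Projectivization.exists_smul_eq_mk_rep K (Pi.single i 1 : Fin 3 → K) h
  rw [← ha]
  rcases eq_or_ne j i with rfl | hj
  · simp [Units.smul_def]
  · simp [hj]

theorem eq_mk_single_iff {i : Fin 3} {h : (Pi.single i 1 : Fin 3 → K) ≠ 0}
    (Q : Projectivization K (Fin 3 → K)) :
    Q = Projectivization.mk K (Pi.single i 1 : Fin 3 → K) h ↔ ∀ j, j ≠ i → Q.rep j = 0 := by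
  constructor
  · rintro rfl j hj
    exact not_not.mp (mt rep_mk_single.mp hj)
  · intro hQ
    conv_lhs => rw [← Q.mk_rep]
    rw [Projectivization.mk_eq_mk_iff']
    refine ⟨Q.rep i, ?_⟩
    ext j
    rcases eq_or_ne j i with rfl | hj
    · simp
    · simp [hj, hQ j hj]

end Local

/-! ### Irreducibility, rationality and singular points of the two families. -/

section Curves

open MvPolynomial

universe u
variable (K : Type u) [Field K]

theorem isHomogeneous_curveC2 (n : ℕ) : (curveC2 K n).IsHomogeneous (2 ^ n + 2) := by
  refine IsHomogeneous.sub ?_ (IsHomogeneous.add (isHomogeneous_X_pow _ _) ?_)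
  · rw [add_comm]; exact (isHomogeneous_X_pow _ _).mul (isHomogeneous_X_pow _ _)
  · have := (isHomogeneous_X K (0 : Fin 3)).mul
      (isHomogeneous_X_pow (R := K) (2 : Fin 3) (2 ^ n + 1))
    exact (by ring : 1 + (2 ^ n + 1) = 2 ^ n + 2) ▸ this

theorem isHomogeneous_curveC {n : ℕ} (hn : 1 ≤ n) : (curveC K n).IsHomogeneous (2 ^ n) := by
  have h2 : 2 ≤ 2 ^ n := by simpa using Nat.pow_le_pow_right two_pos hn
  refine IsHomogeneous.sub (isHomogeneous_X_pow _ _) (IsHomogeneous.add ?_ ?_)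
  · have := (isHomogeneous_X_pow (R := K) (0 : Fin 3) (2 ^ n - 2)).mul
      (isHomogeneous_X_pow (R := K) (2 : Fin 3) 2)
    exact (by omega : 2 ^ n - 2 + 2 = 2 ^ n) ▸ this
  · have := (isHomogeneous_X K (0 : Fin 3)).mul
      (isHomogeneous_X_pow (R := K) (2 : Fin 3) (2 ^ n - 1))
    rwa [(by omega : 1 + (2 ^ n - 1) = 2 ^ n)] at this

/-- Polynomials in three variables as polynomials in the variable `1` over the ring of
polynomials in the other two. -/
def equivPolynomialOne :
    MvPolynomial (Fin 3) K ≃ₐ[K] Polynomial (MvPolynomial (Fin 2) K) :=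
  (renameEquiv K (Equiv.swap (0 : Fin 3) 1)).trans (finSuccEquiv K 2)

theorem equivPolynomialOne_X_zero : equivPolynomialOne K (X 0) = Polynomial.C (X 0) := by
  simpa [equivPolynomialOne] using finSuccEquiv_X_succ (R := K) (n := 2) (j := 0)

theorem equivPolynomialOne_X_one : equivPolynomialOne K (X 1) = Polynomial.X := by
  simp [equivPolynomialOne, finSuccEquiv_X_zero]

theorem equivPolynomialOne_X_two : equivPolynomialOne K (X 2) = Polynomial.C (X 1) := by
  have : Equiv.swap (0 : Fin 3) 1 2 = 2 := by decide
  simpa [equivPolynomialOne, this] using finSuccEquiv_X_succ (R := K) (n := 2) (j := 1)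

variable {K}

theorem not_X_dvd_of_eval {σ : Type*} {i : σ} {f : MvPolynomial σ K} {v : σ → K} (hi : v i = 0)
    (hv : eval v f ≠ 0) : ¬ X i ∣ f := by
  rintro ⟨g, rfl⟩
  exact hv (by simp [hi])

/-- As a polynomial in y this is z² y^q - x(x^(q+1) + z^(q+1)), Eisenstein at x. Its content is
trivial because z does not divide the constant term. -/
theorem irreducible_curveC2 (n : ℕ) : Irreducible (curveC2 K n) := by
  rw [← MulEquiv.irreducible_iff (equivPolynomialOne K)]
  have : equivPolynomialOne K (curveC2 K n) = Polynomial.C (X 1 ^ 2) * Polynomial.X ^ 2 ^ n -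
      Polynomial.C (X 0 * (X 0 ^ (2 ^ n + 1) + X 1 ^ (2 ^ n + 1))) := by
    simp only [curveC2, map_sub, map_add, map_mul, map_pow, equivPolynomialOne_X_zero,
      equivPolynomialOne_X_one, equivPolynomialOne_X_two]
    ring
  rw [this]
  refine irreducible_C_mul_X_pow_sub_C X_prime ?_ ?_ ?_ (by simp)
  · exact not_X_dvd_of_eval (v := ![0, 1]) (by simp) (by simp)
  · exact not_X_dvd_of_eval (v := ![0, 1]) (by simp) (by simp)
  · intro d hd1 hd2
    obtain ⟨i, -, hi⟩ := (dvd_prime_pow X_prime 2).mp hd1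
    rcases Nat.eq_zero_or_pos i with rfl | hpos
    · exact hi.symm.isUnit (by simp)
    · refine absurd (((dvd_pow_self _ hpos.ne').trans hi.symm.dvd).trans hd2) ?_
      exact not_X_dvd_of_eval (v := ![1, 0]) (by simp) (by simp)

theorem irreducible_curveC {n : ℕ} (hn : 2 ≤ n) : Irreducible (curveC K n) := by
  have h4 : 4 ≤ 2 ^ n := by simpa using Nat.pow_le_pow_right two_pos hn
  rw [← MulEquiv.irreducible_iff (equivPolynomialOne K)]
  have : equivPolynomialOne K (curveC K n) = Polynomial.C 1 * Polynomial.X ^ 2 ^ n -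
      Polynomial.C (X 0 * (X 0 ^ (2 ^ n - 3) * X 1 ^ 2 + X 1 ^ (2 ^ n - 1))) := by
    obtain ⟨q, hq⟩ : ∃ q, 2 ^ n - 2 = q + 1 := ⟨2 ^ n - 3, by omega⟩
    have hq' : 2 ^ n - 3 = q := by omega
    rw [hq']
    simp only [curveC, map_sub, map_add, map_mul, map_pow, equivPolynomialOne_X_zero,
      equivPolynomialOne_X_one, equivPolynomialOne_X_two, hq, map_one]
    ring
  rw [this]
  refine irreducible_C_mul_X_pow_sub_C X_prime ?_ ?_ isRelPrime_one_left (by simp)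
  · exact not_X_dvd_of_eval (v := ![0, 1]) (by simp) (by simp)
  · have h3 : 2 ^ n - 3 ≠ 0 := by omega
    exact not_X_dvd_of_eval (v := ![0, 1]) (by simp) (by simp [h3])

variable [CharP K 2]

theorem isRational_curveC2 {n : ℕ} (hn : 1 ≤ n) : IsRational (curveC2 K n) := by
  obtain ⟨N, hN⟩ : ∃ N, 2 ^ n + 2 = 2 * N :=
    ⟨2 ^ (n - 1) + 1, by
      obtain ⟨m, rfl⟩ := Nat.exists_eq_add_of_le' hn
      simp [pow_succ]
      ring⟩
  refine isRational_of_parametrization (isHomogeneous_curveC2 K n) (irreducible_curveC2 n) 2 0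
    ![Polynomial.X ^ 2 ^ n, Polynomial.X + Polynomial.X ^ (2 ^ n + 2), 1] (by simp)
    ?_ ?_ ?_
  · exact (Polynomial.transcendental_X K).pow (by positivity)
  · simp only [curveC2, map_sub, map_add, map_mul, map_pow, aeval_X, Matrix.cons_val]
    rw [add_pow_char_pow]
    ring
  · intro L _ _ x hx hF
    have : CharP L 2 := charP_of_injective_algebraMap (algebraMap K L).injective 2
    simp only [curveC2, map_sub, map_add, map_mul, map_pow, aeval_X, hx] at hF
    obtain ⟨t, ht, hb⟩ := exists_pow_eq_and_eq_add_pow N n (x 0) (x 1) (by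
      rw [← hN]; linear_combination hF)
    refine ⟨t, fun i => ?_⟩
    fin_cases i
    · simp [ht]
    · simp [hb, hN]
    · simp [hx]

theorem isRational_curveC {n : ℕ} (hn : 2 ≤ n) : IsRational (curveC K n) := by
  have h4 : 4 ≤ 2 ^ n := by simpa using Nat.pow_le_pow_right two_pos hn
  obtain ⟨N, hN⟩ : ∃ N, 2 ^ n - 1 = 2 * N + 1 :=
    ⟨2 ^ (n - 1) - 1, by
      obtain ⟨m, rfl⟩ := Nat.exists_eq_add_of_le' hn
      simp [pow_succ] at *
      omega⟩
  refine isRational_of_parametrization (isHomogeneous_curveC K (by omega)) (irreducible_curveC hn) 0 2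
    ![1, Polynomial.X ^ 2 + Polynomial.X ^ (2 ^ n - 1), Polynomial.X ^ 2 ^ n] (by simp)
    ?_ ?_ ?_
  · exact (Polynomial.transcendental_X K).pow (by positivity)
  · simp only [curveC, map_sub, map_add, map_mul, map_pow, aeval_X, Matrix.cons_val]
    rw [add_pow_char_pow, one_pow]
    ring
  · intro L _ _ x hx hF
    have : CharP L 2 := charP_of_injective_algebraMap (algebraMap K L).injective 2
    simp only [curveC, map_sub, map_add, map_mul, map_pow, aeval_X, hx, one_pow] at hF
    obtain ⟨t, ht, hb⟩ := exists_pow_eq_and_eq_sq_add_pow N n (x 2) (x 1) (by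
      rw [← hN]; linear_combination hF)
    refine ⟨t, fun i => ?_⟩
    fin_cases i
    · simp [hx]
    · simp [hb, hN]
    · simp [ht]

theorem isSingularPoint_curveC2_iff {n : ℕ} (hn : 1 ≤ n) (Q : Projectivization K (Fin 3 → K)) :
    IsSingularPoint (curveC2 K n) Q ↔ ∀ j, j ≠ 1 → Q.rep j = 0 := by
  have hn0 : n ≠ 0 := by omega
  have two : (2 : K) = 0 := CharTwo.two_eq_zero
  constructor
  · rintro ⟨h0, h1⟩
    have hz : Q.rep 2 = 0 := by
      -- The exponent q + 2 is zero in K, so the x-derivative is z^(q+1) up to sign.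
      have := h1 0
      simp [curveC2, pderiv_X, two, hn0] at this
      exact this
    have hx : Q.rep 0 = 0 := by
      simpa [curveC2, hz] using h0
    intro j hj
    fin_cases j
    · exact hx
    · exact absurd rfl hj
    · exact hz
  · intro h
    have hx := h 0 (by decide)
    have hz := h 2 (by decide)
    refine ⟨by simp [curveC2, hx, hz], fun i => ?_⟩
    fin_cases i <;> simp [curveC2, hx, hz, pderiv_X, two]

theorem isSingularPoint_curveC_iff {n : ℕ} (hn : 2 ≤ n) (Q : Projectivization K (Fin 3 → K)) :
    IsSingularPoint (curveC K n) Q ↔ ∀ j, j ≠ 0 → Q.rep j = 0 := by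
  have hn0 : n ≠ 0 := by omega
  have two : (2 : K) = 0 := CharTwo.two_eq_zero
  have h4 : 4 ≤ 2 ^ n := by simpa using Nat.pow_le_pow_right two_pos hn
  have hq2 : ((2 ^ n - 2 : ℕ) : K) = 0 := by
    rw [Nat.cast_sub (by omega)]; simp [two, hn0]
  have e1 : 2 ^ n - 1 ≠ 0 := by omega
  have e2 : 2 ^ n - 1 - 1 ≠ 0 := by omega
  constructor
  · rintro ⟨h0, h1⟩
    have hz : Q.rep 2 = 0 := by
      -- The exponent q - 2 is zero in K, so the x-derivative is z^(q-1) up to sign.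
      have := h1 0
      simp [curveC, pderiv_X, hq2, e1] at this
      exact this
    have hx : Q.rep 1 = 0 := by
      simpa [curveC, hz, e1] using h0
    intro j hj
    fin_cases j
    · exact absurd rfl hj
    · exact hx
    · exact hz
  · intro h
    have hx := h 1 (by decide)
    have hz := h 2 (by decide)
    refine ⟨by simp [curveC, hx, hz, e1], fun i => ?_⟩
    fin_cases i <;> simp [curveC, hx, hz, pderiv_X, two, e1, e2]

end Curves

/-! ### Local equations and type of the singular points. -/

section Main

open MvPowerSeries

variable {K : Type*} [Field K] [CharP K 2]

theorem localEquation_curveC2 {n N : ℕ} (hN : 2 ^ n = 2 * N) (P : Projectivization K (Fin 3 → K))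
    (hP : ∀ j, j ≠ 1 → P.rep j = 0) :
    localEquation (curveC2 K n) P 1 =
      X 1 ^ 2 + X 0 ^ (2 * (N + 1)) + X 0 ^ 1 * X 1 ^ (2 * N + 1) := by
  have : CharP (MvPowerSeries (Fin 2) K) 2 := charP_of_injective_algebraMap
    (algebraMap K (MvPowerSeries (Fin 2) K)).injective 2
  have hx := hP 0 (by decide)
  have hz := hP 2 (by decide)
  have s0 : (1 : Fin 3).succAbove (0 : Fin 2) = 0 := by decide
  have s1 : (1 : Fin 3).succAbove (1 : Fin 2) = 2 := by decide
  have e0 := Fin.insertNth_apply_succAbove (α := fun _ => MvPolynomial (Fin 2) K) (1 : Fin 3) 1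
    (fun l => MvPolynomial.X l + MvPolynomial.C (P.rep ((1 : Fin 3).succAbove l) / P.rep 1)) 0
  have e1 := Fin.insertNth_apply_succAbove (α := fun _ => MvPolynomial (Fin 2) K) (1 : Fin 3) 1
    (fun l => MvPolynomial.X l + MvPolynomial.C (P.rep ((1 : Fin 3).succAbove l) / P.rep 1)) 1
  have e2 := Fin.insertNth_apply_same (α := fun _ => MvPolynomial (Fin 2) K) (1 : Fin 3) 1
    (fun l => MvPolynomial.X l + MvPolynomial.C (P.rep ((1 : Fin 3).succAbove l) / P.rep 1))
  rw [s0, hx, zero_div, map_zero, add_zero] at e0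
  rw [s1, hz, zero_div, map_zero, add_zero] at e1
  simp only [localEquation, curveC2, map_add, map_mul, map_pow, MvPolynomial.aeval_X,
    e0, e1, e2, CharTwo.sub_eq_add]
  simp [hN, mul_add, add_assoc]

theorem localEquation_curveC {n N : ℕ} (hN : 2 ^ n = 2 * N) (hN1 : 1 ≤ N)
    (P : Projectivization K (Fin 3 → K)) (hP : ∀ j, j ≠ 0 → P.rep j = 0) :
    localEquation (curveC K n) P 0 =
      X 1 ^ 2 + X 0 ^ (2 * N) + X 0 ^ 0 * X 1 ^ (2 * (N - 1) + 1) := by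
  have : CharP (MvPowerSeries (Fin 2) K) 2 := charP_of_injective_algebraMap
    (algebraMap K (MvPowerSeries (Fin 2) K)).injective 2
  have hx := hP 1 (by decide)
  have hz := hP 2 (by decide)
  have s0 : (0 : Fin 3).succAbove (0 : Fin 2) = 1 := by decide
  have s1 : (0 : Fin 3).succAbove (1 : Fin 2) = 2 := by decide
  have e0 := Fin.insertNth_apply_succAbove (α := fun _ => MvPolynomial (Fin 2) K) (0 : Fin 3) 1
    (fun l => MvPolynomial.X l + MvPolynomial.C (P.rep ((0 : Fin 3).succAbove l) / P.rep 0)) 0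
  have e1 := Fin.insertNth_apply_succAbove (α := fun _ => MvPolynomial (Fin 2) K) (0 : Fin 3) 1
    (fun l => MvPolynomial.X l + MvPolynomial.C (P.rep ((0 : Fin 3).succAbove l) / P.rep 0)) 1
  have e2 := Fin.insertNth_apply_same (α := fun _ => MvPolynomial (Fin 2) K) (0 : Fin 3) 1
    (fun l => MvPolynomial.X l + MvPolynomial.C (P.rep ((0 : Fin 3).succAbove l) / P.rep 0))
  rw [s0, hx, zero_div, map_zero, add_zero] at e0
  rw [s1, hz, zero_div, map_zero, add_zero] at e1
  have h1 : 2 ^ n - 1 = 2 * (N - 1) + 1 := by omega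
  simp only [localEquation, curveC, map_add, map_mul, map_pow, MvPolynomial.aeval_X,
    e0, e1, e2, h1, CharTwo.sub_eq_add]
  simp [hN, ← add_assoc, add_comm]

theorem singularity_curveC2 {n : ℕ} (hn : 1 ≤ n) (P : Projectivization K (Fin 3 → K))
    (hP : ∀ j, P.rep j ≠ 0 ↔ j = 1) :
    HasMultiplicity (curveC2 K n) P 2 ∧ IsUnibranchAt (curveC2 K n) P ∧
      IsTypeAEven (curveC2 K n) P (2 ^ n * (2 ^ n + 1)) ∧
      HasNormalFormAt (curveC2 K n) P (formA K (2 ^ n * (2 ^ n + 1))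
        (2 ^ n * (2 ^ n + 1) / 2 + 2 ^ (n - 1) + 1)) := by
  obtain ⟨l, rfl⟩ := Nat.exists_eq_add_of_le' hn
  have hl : 1 ≤ 2 ^ l := Nat.one_le_two_pow
  have hloc := localEquation_curveC2 (by rw [pow_succ, mul_comm] : 2 ^ (l + 1) = 2 * 2 ^ l) P
    (fun j hj => not_not.mp (mt (hP j).mp hj))
  have hdiv : 2 ^ (l + 1) * (2 ^ (l + 1) + 1) / 2 = 2 ^ l * (2 ^ (l + 1) + 1) := by
    rw [pow_succ, mul_comm (2 ^ l) 2, mul_assoc, Nat.mul_div_cancel_left _ two_pos]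
  have heven : Even (2 ^ (l + 1) * (2 ^ (l + 1) + 1)) := Nat.even_mul_succ_self _
  have hnf : HasNormalFormAt (curveC2 K (l + 1)) P (formA K (2 ^ (l + 1) * (2 ^ (l + 1) + 1))
      (2 ^ (l + 1) * (2 ^ (l + 1) + 1) / 2 + 2 ^ (l + 1 - 1) + 1)) := fun i hi => by
    rw [(hP i).mp hi, hloc]
    -- Here a = q/2 + 1, ε = 1 and 2k + 1 = q + 1; solving the weight condition gives e = q + 1.
    refine formallyEquivalent_formA_of_eq (l := l) (e := 2 ^ (l + 1) + 1) (by omega) ?_ ?_ ?_ ?_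
    · exact Even.add_one (by simp [Nat.even_pow])
    · rw [pow_succ]; ring
    · rw [hdiv, Nat.add_sub_cancel, pow_succ]; ring
    · obtain ⟨q, hq⟩ : ∃ q, 2 ^ (l + 1) = q + 1 := ⟨2 ^ (l + 1) - 1, by omega⟩
      have hq' : 2 * 2 ^ l = q + 1 := by rw [← hq, pow_succ, mul_comm]
      rw [mul_add 2, hq', hq, Nat.add_sub_cancel]
      ring
  have hlt : 2 ^ (l + 1) * (2 ^ (l + 1) + 1) / 2 <
      2 ^ (l + 1) * (2 ^ (l + 1) + 1) / 2 + 2 ^ (l + 1 - 1) + 1 := by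
    rw [add_assoc]; exact Nat.lt_add_of_pos_right (Nat.succ_pos _)
  refine ⟨fun i hi => ?_, fun i hi => ?_, ⟨heven, Or.inr ⟨_, hlt, ?_, hnf⟩⟩, hnf⟩
  · rw [(hP i).mp hi, hloc]
    exact order_eq_two (by omega) hl
  · exact (hnf i hi).irreducible (irreducible_formA heven hlt)
  · rw [hdiv, Nat.add_sub_cancel, pow_succ]
    nlinarith

theorem singularity_curveC {n : ℕ} (hn : 2 ≤ n) (P : Projectivization K (Fin 3 → K))
    (hP : ∀ j, P.rep j ≠ 0 ↔ j = 0) :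
    HasMultiplicity (curveC K n) P 2 ∧ IsTypeAEven (curveC K n) P ((2 ^ n - 1) * (2 ^ n - 2)) := by
  obtain ⟨l, rfl⟩ := Nat.exists_eq_add_of_le' (by omega : 1 ≤ n)
  obtain ⟨k, hk⟩ : ∃ k, 2 ^ l = k + 2 := Nat.exists_eq_add_of_le' (by
    simpa using Nat.pow_le_pow_right two_pos (by omega : 1 ≤ l))
  have hq : 2 ^ (l + 1) = 2 * (k + 2) := by rw [pow_succ, hk, mul_comm]
  have hloc := localEquation_curveC hq (by omega) P (fun j hj => not_not.mp (mt (hP j).mp hj))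
  have q1 : 2 * (k + 2) - 1 = 2 * k + 3 := by omega
  have q2 : 2 * (k + 2) - 2 = 2 * (k + 1) := by omega
  have hdiv : (2 * k + 3) * (2 * (k + 1)) / 2 = (2 * k + 3) * (k + 1) := by
    rw [mul_left_comm, Nat.mul_div_cancel_left _ two_pos]
  rw [hq, q1, q2]
  refine ⟨fun i hi => ?_, ⟨(2 * k + 3) * (k + 1), by ring⟩,
    Or.inr ⟨2 * (k + 2) * (k + 1), ?_, ?_, ?_⟩⟩
  · rw [(hP i).mp hi, hloc]
    exact order_eq_two (by omega) (by omega)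
  · rw [hdiv]; nlinarith
  · nlinarith
  · intro i hi
    rw [(hP i).mp hi, hloc]
    -- With q = 2(k + 2), the data are a = q/2, ε = 0 and the odd exponent q - 1, so the weight
    -- condition gives e = q - 3.
    refine formallyEquivalent_formA_of_eq (l := l) (e := 2 * k + 1) (by omega) (by simp) ?_ ?_ ?_
    · rw [hk, Nat.add_sub_assoc (by omega)]; norm_num; ring
    · rw [Nat.add_sub_assoc (by omega)]; norm_num
    · rw [hq, q1]; ring

end Main

end PlaneCurve

end

theorem mainTheorem1 (K : Type*) [Field K] [CharP K 2] [PerfectField K] (n : ℕ) :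
    (1 ≤ n →
      PlaneCurve.IsIntegralOfDegree (PlaneCurve.curveC2 K n) (2 ^ n + 2) ∧
      PlaneCurve.IsRational (PlaneCurve.curveC2 K n) ∧
      ∃ P : Projectivization K (Fin 3 → K),
        (∀ Q, PlaneCurve.IsSingularPoint (PlaneCurve.curveC2 K n) Q ↔ Q = P) ∧
        PlaneCurve.HasMultiplicity (PlaneCurve.curveC2 K n) P 2 ∧
        PlaneCurve.IsUnibranchAt (PlaneCurve.curveC2 K n) P ∧
        PlaneCurve.IsTypeAEven (PlaneCurve.curveC2 K n) P (2 ^ n * (2 ^ n + 1)) ∧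
        PlaneCurve.HasNormalFormAt (PlaneCurve.curveC2 K n) P
          (PlaneCurve.formA K (2 ^ n * (2 ^ n + 1))
            (2 ^ n * (2 ^ n + 1) / 2 + 2 ^ (n - 1) + 1))) ∧
    (2 ≤ n →
      PlaneCurve.IsIntegralOfDegree (PlaneCurve.curveC K n) (2 ^ n) ∧
      PlaneCurve.IsRational (PlaneCurve.curveC K n) ∧
      ∃ P : Projectivization K (Fin 3 → K),
        (∀ Q, PlaneCurve.IsSingularPoint (PlaneCurve.curveC K n) Q ↔ Q = P) ∧
        PlaneCurve.HasMultiplicity (PlaneCurve.curveC K n) P 2 ∧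
        PlaneCurve.IsTypeAEven (PlaneCurve.curveC K n) P ((2 ^ n - 1) * (2 ^ n - 2))) := by
  have hne : ∀ i : Fin 3, (Pi.single i 1 : Fin 3 → K) ≠ 0 := fun i => by simp
  refine ⟨fun hn => ⟨⟨PlaneCurve.isHomogeneous_curveC2 K n, PlaneCurve.irreducible_curveC2 n⟩,
    PlaneCurve.isRational_curveC2 hn, Projectivization.mk K _ (hne 1), fun Q => ?_,
    PlaneCurve.singularity_curveC2 hn _ fun _ => PlaneCurve.rep_mk_single⟩,
    fun hn => ⟨⟨PlaneCurve.isHomogeneous_curveC K (by omega), PlaneCurve.irreducible_curveC hn⟩,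
    PlaneCurve.isRational_curveC hn, Projectivization.mk K _ (hne 0), fun Q => ?_,
    PlaneCurve.singularity_curveC hn _ fun _ => PlaneCurve.rep_mk_single⟩⟩
  · rw [PlaneCurve.isSingularPoint_curveC2_iff hn, PlaneCurve.eq_mk_single_iff]
  · rw [PlaneCurve.isSingularPoint_curveC_iff hn, PlaneCurve.eq_mk_single_iff]
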